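/- Let $n\ge 1$, let $M_n$ be the algebra of complex $n\times n$ matrices, and let $\mathbb{D}\le \mathrm{SU}(n)$ be the group of diagonal special unitary $n\times n$ matrices. For every $X\in\mathbb{D}$ there are unique real numbers $$x_1\le x_2\le\cdots\le x_n\le x_1+1,\qquad \sum_{j=1}^n x_j=0,$$ such that $\exp(2\pi i x_1),\dots,\exp(2\pi i x_n)$ are the eigenvalues of $X$, counted with multiplicity; put $\lambda_j(X):=\exp(2\pi i x_j)$. Let $\phi:\mathbb{D}\to M_n$ be a continuous map such that, for all $X,Y\in\mathbb{D}$, the matrices $\phi(X)$ and $X$ have the same set of eigenvalues, and $\phi(X)$ and $\phi(Y)$ commute whenever $X$ and $Y$ do. Then there is $T\in\mathrm{GL}(n,\mathbb{C})$ such that at least one of the following holds: (a) $\phi(X)=TXT^{-1}$ for all $X\in\mathbb{D}$; (b) $\phi(X)=T\,\mathrm{diag}(\lambda_1(X),\dots,\lambda_n(X))\,T^{-1}$ for all $X\in\mathbb{D}$. -/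

import Mathlib

/-- The group of diagonal special unitary `n × n` matrices, as a subgroup of `SU(n)`. -/
def diagSU (n : ℕ) : Subgroup (Matrix.specialUnitaryGroup (Fin n) ℂ) where
  carrier := {X | (X : Matrix (Fin n) (Fin n) ℂ).IsDiag}
  one_mem' := Matrix.isDiag_one
  mul_mem' := by
    intro X Y hX hY
    have hX' : (X : Matrix (Fin n) (Fin n) ℂ).IsDiag := hX
    have hY' : (Y : Matrix (Fin n) (Fin n) ℂ).IsDiag := hY
    change ((X : Matrix (Fin n) (Fin n) ℂ) * (Y : Matrix (Fin n) (Fin n) ℂ)).IsDiag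
    rw [← hX'.diagonal_diag, ← hY'.diagonal_diag, Matrix.diagonal_mul_diagonal]
    exact Matrix.isDiag_diagonal _
  inv_mem' := by
    intro X hX
    exact Matrix.IsDiag.conjTranspose hX

/-- The underlying complex matrix of an element of `diagSU n`. -/
def diagSU.toMatrix {n : ℕ} (X : diagSU n) : Matrix (Fin n) (Fin n) ℂ :=
  ((X : Matrix.specialUnitaryGroup (Fin n) ℂ) : Matrix (Fin n) (Fin n) ℂ)

/-- `φ(X)` and `X` have the same spectrum, as sets of complex numbers. -/
def SpectrumPreserving {n : ℕ} (φ : diagSU n → Matrix (Fin n) (Fin n) ℂ) : Prop :=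
  ∀ X : diagSU n, spectrum ℂ (φ X) = spectrum ℂ (diagSU.toMatrix X)

/-- `φ(X)` and `φ(Y)` commute whenever `X` and `Y` do. -/
def CommutativityPreserving {n : ℕ} (φ : diagSU n → Matrix (Fin n) (Fin n) ℂ) : Prop :=
  ∀ X Y : diagSU n, Commute (diagSU.toMatrix X) (diagSU.toMatrix Y) → Commute (φ X) (φ Y)

/-- The conjugation `Ad_T A = T A T⁻¹` by an invertible matrix `T`. -/
def matrixAd {n : ℕ} (T : GL (Fin n) ℂ) (A : Matrix (Fin n) (Fin n) ℂ) :
    Matrix (Fin n) (Fin n) ℂ :=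
  (T : Matrix (Fin n) (Fin n) ℂ) * A * ((T⁻¹ : GL (Fin n) ℂ) : Matrix (Fin n) (Fin n) ℂ)

/-- The number `exp(2πi t)` on the unit circle. -/
noncomputable def circleExp (t : ℝ) : ℂ :=
  Complex.exp (2 * (Real.pi : ℂ) * Complex.I * (t : ℂ))

/-- `x₁ ≤ ⋯ ≤ xₙ ≤ x₁ + 1`, `∑ xⱼ = 0`, and the numbers `exp(2πi xⱼ)` are the eigenvalues of `X`,
listed with algebraic multiplicity. For a monotone `x`, the field `spread` says exactly that
the last entry is at most the first one plus `1`. -/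
structure IsOrderedEigenangles {n : ℕ} (X : Matrix (Fin n) (Fin n) ℂ) (x : Fin n → ℝ) : Prop where
  mono : Monotone x
  spread : ∀ i j, x i ≤ x j + 1
  sum_eq_zero : ∑ j, x j = 0
  roots_eq : X.charpoly.roots = (Finset.univ : Finset (Fin n)).val.map (fun j => circleExp (x j))

/-!
All `φ X` commute with the image of an element with distinct eigenvalues, so they are diagonal in a
common basis, and each diagonal entry is a continuous choice `f X` of an eigenvalue of `X`. Write
the angles of `X` as `x ∘ u`, with `x` in the fundamental alcove and `u` a permutation. The interior
of the alcove is connected and its points have distinct eigenvalues, so for fixed `u` the function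
`f` picks the `t u`-th ordered eigenvalue. If `v i = u i`, the chambers of `u` and `v` share a point
at which the eigenvalue in position `i` differs from all the others, which agree with each other:
hence `t u = u i` implies `t v = u i`. So `t` is constant or an evaluation `u ↦ u i`, that is, `f`
is an ordered eigenvalue or a diagonal entry of `X`. Two entries of `φ` of different types would
coincide at a suitable element with distinct eigenvalues.
-/

open Function Matrix

lemma circleExp_eq_coe_circleExp (t : ℝ) : circleExp t = Circle.exp (2 * Real.pi * t) := by
  rw [circleExp, Circle.coe_exp]
  push_cast
  ring_nf

lemma norm_circleExp (t : ℝ) : ‖circleExp t‖ = 1 := by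
  rw [circleExp_eq_coe_circleExp, Circle.norm_coe]

lemma continuous_circleExp : Continuous circleExp := by
  unfold circleExp
  fun_prop

lemma circleExp_eq_circleExp_iff {s t : ℝ} : circleExp s = circleExp t ↔ ∃ m : ℤ, s = t + m := by
  simp only [circleExp_eq_coe_circleExp, Circle.coe_inj, Circle.exp_eq_exp]
  refine exists_congr fun m => ?_
  rw [mul_comm (m : ℝ), ← mul_add, mul_right_inj' Real.two_pi_pos.ne']

lemma circleExp_zero : circleExp 0 = 1 := by
  simp [circleExp]

lemma circleExp_sub_one (t : ℝ) : circleExp (t - 1) = circleExp t :=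
  circleExp_eq_circleExp_iff.2 ⟨-1, by push_cast; ring⟩

lemma circleExp_fract (t : ℝ) : circleExp (Int.fract t) = circleExp t :=
  circleExp_eq_circleExp_iff.2 ⟨-⌊t⌋, by rw [Int.fract]; push_cast; ring⟩

lemma circleExp_sum {ι : Type*} (s : Finset ι) (x : ι → ℝ) :
    circleExp (∑ i ∈ s, x i) = ∏ i ∈ s, circleExp (x i) := by
  simp only [circleExp, ← Complex.exp_sum, ← Finset.mul_sum, Complex.ofReal_sum]

lemma circleExp_sub_eq_circleExp_sub_iff {s t c : ℝ} :
    circleExp (s - c) = circleExp (t - c) ↔ circleExp s = circleExp t := by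
  simp only [circleExp_eq_circleExp_iff, sub_add_eq_add_sub, sub_left_inj]

lemma exists_circleExp_eq {z : ℂ} (hz : ‖z‖ = 1) : ∃ t, circleExp t = z := by
  refine ⟨z.arg / (2 * Real.pi), ?_⟩
  rw [circleExp_eq_coe_circleExp, mul_div_cancel₀ _ Real.two_pi_pos.ne']
  simpa using congrArg Subtype.val (Circle.exp_arg ⟨z, mem_sphere_zero_iff_norm.2 hz⟩)

lemma univ_val_map_eq_iff {α β : Type*} [Fintype α] {f g : α → β} :
    Finset.univ.val.map f = Finset.univ.val.map g ↔ ∃ u : Equiv.Perm α, f = g ∘ u := by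
  classical
  constructor
  · intro h
    have hcard (b : β) : Fintype.card {a // f a = b} = Fintype.card {a // g a = b} := by
      simpa [Multiset.count_map, Fintype.card_subtype, Finset.card, eq_comm]
        using congrArg (Multiset.count b) h
    exact ⟨.ofFiberEquiv fun b => Fintype.equivOfCardEq (hcard b),
      funext fun a => (Equiv.ofFiberEquiv_map _ a).symm⟩
  · rintro ⟨u, rfl⟩
    rw [← Multiset.map_map, Multiset.map_univ_val_equiv]

lemma injective_of_range_eq {ι β : Type*} [Finite ι] {f g : ι → β}
    (h : Set.range f = Set.range g) (hg : Injective g) : Injective f := by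
  rw [← Set.image_univ, ← Set.image_univ] at h
  rw [← Set.injOn_univ]
  exact Set.injOn_of_ncard_image_eq (by rw [h, Set.ncard_image_of_injective _ hg])

lemma exists_perm_eq_comp_of_injective {X ι β : Type*} [Finite ι] {f e : X → ι → β} {x₀ : X}
    (hinj : Injective (f x₀)) (h : ∀ i, ∃ j, ∀ x, f x i = e x j) :
    ∃ σ : Equiv.Perm ι, ∀ x, f x = e x ∘ σ := by
  choose s hs using h
  have hs_inj : Injective s := fun i k hik => hinj (by rw [hs, hs, hik])
  exact ⟨.ofBijective s hs_inj.bijective_of_finite, fun x => funext fun i => hs i x⟩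

lemma forall_eq_or_forall_eq {ι α β : Type*} {f : ι → α} {g : ι → β}
    (h : ∀ x y, f x = f y ∨ g x = g y) : (∀ x y, f x = f y) ∨ ∀ x y, g x = g y := by
  by_contra! ⟨⟨a, b, hab⟩, c, d, hcd⟩
  have hg (x : ι) : g x = g a := by grind only [h x a, h x b, h a b]
  exact hcd ((hg c).trans (hg d).symm)

/- Call a pair `(i, a)` marked if `u i = a = t u` for some `u`; the hypothesis makes `t u = a` for
every `u` with `u i = a`. Two marked pairs in different rows and columns lie on the graph of a
common permutation, so all marked pairs lie in one row or in one column. -/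
lemma exists_forall_eq_or_exists_forall_eq_apply {α : Type*} (t : Equiv.Perm α → α)
    (ht : ∀ u v : Equiv.Perm α, ∀ i, t u = u i → v i = u i → t v = t u) :
    (∃ a, ∀ u, t u = a) ∨ ∃ i, ∀ u, t u = u i := by
  have hline (u v : Equiv.Perm α) : t u = t v ∨ u.symm (t u) = v.symm (t v) := by
    by_contra! ⟨hval, hpos⟩
    obtain ⟨w, hwu, hwv⟩ := MulAction.is_two_pretransitive_iff.1
      (Equiv.Perm.isMultiplyPretransitive α 2) hpos hval
    have htu : t w = t u := ht u w _ (u.apply_symm_apply _).symm (by simpa using hwu)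
    have htv : t w = t v := ht v w _ (v.apply_symm_apply _).symm (by simpa using hwv)
    exact hval (htu.symm.trans htv)
  rcases forall_eq_or_forall_eq hline with h | h
  · exact .inl ⟨t 1, fun u => h u 1⟩
  · exact .inr ⟨t 1, fun u => u.symm_apply_eq.1 (h u 1)⟩

lemma exists_eqOn_of_forall_exists_eq {X Y ι : Type*} [TopologicalSpace X] [TopologicalSpace Y]
    [T2Space Y] [Finite ι] {s : Set X} (hs : IsConnected s) {g : X → Y} {h : ι → X → Y}
    (hg : ContinuousOn g s) (hh : ∀ i, ContinuousOn (h i) s)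
    (hinj : ∀ x ∈ s, Injective fun i => h i x) (hex : ∀ x ∈ s, ∃ i, g x = h i x) :
    ∃ i, Set.EqOn g (h i) s := by
  have : PreconnectedSpace s := isPreconnected_iff_preconnectedSpace.1 hs.isPreconnected
  obtain ⟨x₀, hx₀⟩ := hs.nonempty
  obtain ⟨i, hi⟩ := hex x₀ hx₀
  let E (j : ι) : Set s := {x | g x = h j x}
  have hclosed (j : ι) : IsClosed (E j) := isClosed_eq hg.domRestrict (hh j).domRestrict
  have hcompl : (E i)ᶜ = ⋃ j ∈ {j | j ≠ i}, E j := by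
    ext x
    simp only [E, Set.mem_compl_iff, Set.mem_ofPred_eq, Set.mem_iUnion, exists_prop]
    constructor
    · intro hx
      obtain ⟨j, hj⟩ := hex x x.2
      exact ⟨j, fun hji => hx (hji ▸ hj), hj⟩
    · rintro ⟨j, hji, hj⟩ hx
      exact hji (hinj x x.2 (hj.symm.trans hx))
  have hopen : IsOpen (E i) := by
    rw [← isClosed_compl_iff, hcompl]
    exact (Set.toFinite _).isClosed_biUnion fun j _ => hclosed j
  have huniv : E i = Set.univ := IsClopen.eq_univ ⟨hclosed i, hopen⟩ ⟨⟨x₀, hx₀⟩, hi⟩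
  exact ⟨i, fun x hx => huniv.ge (Set.mem_univ (⟨x, hx⟩ : s))⟩

section Diagonalization

variable {ι K : Type*} [Fintype ι] [DecidableEq ι]

lemma roots_charpoly_diagonal [CommRing K] [IsDomain K] (d : ι → K) :
    (diagonal d).charpoly.roots = Finset.univ.val.map d := by
  rw [charpoly_diagonal, Finset.prod_eq_multiset_prod]
  simpa only [Multiset.map_map, comp_def] using
    Polynomial.roots_multiset_prod_X_sub_C (Finset.univ.val.map d)

lemma diagonal_mem_specialUnitaryGroup_iff [RCLike K] {d : ι → K} :
    diagonal d ∈ specialUnitaryGroup ι K ↔ (∀ i, ‖d i‖ = 1) ∧ ∏ i, d i = 1 := by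
  rw [mem_specialUnitaryGroup_iff, mem_unitaryGroup_iff, star_eq_conjTranspose,
    diagonal_conjTranspose, diagonal_mul_diagonal, det_diagonal, ← diagonal_one,
    diagonal_injective.eq_iff, funext_iff]
  refine and_congr_left fun _ => forall_congr' fun i => ?_
  rw [Pi.star_apply, RCLike.star_def, RCLike.mul_conj, ← RCLike.ofReal_pow, ← RCLike.ofReal_one,
    RCLike.ofReal_inj, pow_eq_one_iff_of_nonneg (norm_nonneg _) two_ne_zero]

lemma isDiag_of_commute_diagonal [CommRing K] [NoZeroDivisors K] {B : Matrix ι ι K} {d : ι → K}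
    (hd : Injective d) (h : Commute B (diagonal d)) : B.IsDiag := by
  intro i j hij
  have hentry : B i j * d j = d i * B i j := by
    simpa only [mul_diagonal, diagonal_mul] using congrFun (congrFun h.eq i) j
  have hzero : B i j * (d j - d i) = 0 := by linear_combination hentry
  exact (mul_eq_zero.1 hzero).resolve_right (sub_ne_zero.2 (hd.ne hij.symm))

variable [Field K]

lemma exists_inv_mul_mul_eq_diagonal {A : Matrix ι ι K} {d : ι → K} (hd : Injective d)
    (hA : ∀ i, d i ∈ spectrum K A) :
    ∃ T : GL ι K, (↑T⁻¹ : Matrix ι ι K) * A * T = diagonal d := by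
  have heigen (i : ι) : ∃ v, Module.End.HasEigenvector (toLin' A) (d i) v :=
    (Module.End.hasEigenvalue_iff_mem_spectrum.2
      ((spectrum_toLin' A).symm ▸ hA i)).exists_hasEigenvector
  choose v hv using heigen
  obtain ⟨T, hT⟩ : IsUnit (of v)ᵀ := linearIndependent_cols_iff_isUnit.1
    (Module.End.eigenvectors_linearIndependent' _ d hd v hv)
  have hAT : A * T = T * diagonal d := by
    ext i j
    rw [mul_diagonal, hT]
    simpa [mul_apply, mulVec, dotProduct, mul_comm] using congrFun (hv j).apply_eq_smul i
  exact ⟨T, by rw [mul_assoc, hAT, Units.inv_mul_cancel_left]⟩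

lemma exists_forall_commute_isDiag {A : Matrix ι ι K} {d : ι → K} (hd : Injective d)
    (hA : ∀ i, d i ∈ spectrum K A) :
    ∃ T : GL ι K, ∀ B, Commute B A → ((↑T⁻¹ : Matrix ι ι K) * B * T).IsDiag := by
  obtain ⟨T, hT⟩ := exists_inv_mul_mul_eq_diagonal hd hA
  refine ⟨T, fun B hBA => isDiag_of_commute_diagonal hd ?_⟩
  rw [← hT, commute_iff_eq]
  simp only [mul_assoc, Units.mul_inv_cancel_left]
  rw [hBA.left_comm]

end Diagonalization

lemma matrixAd_mul {n : ℕ} (T U : GL (Fin n) ℂ) (A : Matrix (Fin n) (Fin n) ℂ) :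
    matrixAd (T * U) A = matrixAd T (matrixAd U A) := by
  simp only [matrixAd, _root_.mul_inv_rev, Units.val_mul, mul_assoc]

lemma exists_matrixAd_diagonal_eq_diagonal_comp {n : ℕ} (σ : Equiv.Perm (Fin n)) :
    ∃ P : GL (Fin n) ℂ, ∀ d : Fin n → ℂ, matrixAd P (diagonal d) = diagonal (d ∘ σ) := by
  refine ⟨⟨σ.permMatrix ℂ, σ⁻¹.permMatrix ℂ, ?_, ?_⟩, fun d => ?_⟩
  · rw [← permMatrix_mul, inv_mul_cancel, permMatrix_one]
  · rw [← permMatrix_mul, mul_inv_cancel, permMatrix_one]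
  · change σ.permMatrix ℂ * diagonal d * σ⁻¹.permMatrix ℂ = _
    rw [Equiv.Perm.permMatrix, Equiv.Perm.permMatrix, PEquiv.toMatrix_toPEquiv_mul,
      PEquiv.mul_toMatrix_toPEquiv, submatrix_submatrix]
    exact submatrix_diagonal d σ σ.injective

lemma exists_forall_eq_matrixAd_diagonal {X : Type*} {n : ℕ} {T : GL (Fin n) ℂ}
    {φ : X → Matrix (Fin n) (Fin n) ℂ} {f e : X → Fin n → ℂ} {x₀ : X}
    (hφ : ∀ x, φ x = matrixAd T (diagonal (f x))) (hinj : Injective (f x₀))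
    (h : ∀ i, ∃ j, ∀ x, f x i = e x j) :
    ∃ T' : GL (Fin n) ℂ, ∀ x, φ x = matrixAd T' (diagonal (e x)) := by
  obtain ⟨σ, hσ⟩ := exists_perm_eq_comp_of_injective hinj h
  obtain ⟨P, hP⟩ := exists_matrixAd_diagonal_eq_diagonal_comp σ
  exact ⟨T * P, fun x => by rw [hφ, hσ, matrixAd_mul, hP]⟩

/-- The closed fundamental alcove of `SU(n)`: by `diagSU.isOrderedEigenangles_iff`, the
ordered eigenangles of the elements of `diagSU n` are its points. -/
def alcove (n : ℕ) : Set (Fin n → ℝ) :=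
  {x | Monotone x ∧ (∀ i j, x i ≤ x j + 1) ∧ ∑ j, x j = 0}

/-- The open fundamental alcove, whose points are the ordered eigenangles of the elements of
`diagSU n` with pairwise distinct eigenvalues. -/
def openAlcove (n : ℕ) : Set (Fin n → ℝ) :=
  {x | StrictMono x ∧ (∀ i j, x i < x j + 1) ∧ ∑ j, x j = 0}

/- The shifts `x i + k` (`k : ℤ`) form a sequence with exactly `n` terms per unit interval; the sum
counts its terms up to `c`, with those of the first period removed. -/
lemma le_iff_neg_card_Ioi_le_sum_floor {ι : Type*} [Fintype ι] [LinearOrder ι]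
    [LocallyFiniteOrderTop ι] {x : ι → ℝ} (hmono : Monotone x) (hspread : ∀ i j, x i ≤ x j + 1)
    (j : ι) (c : ℝ) : x j ≤ c ↔ -((Finset.Ioi j).card : ℤ) ≤ ∑ i, ⌊c - x i⌋ := by
  have hcard (s : Finset ι) : ∑ i, (if i ∈ s then (-1 : ℤ) else 0) = -(s.card : ℤ) := by
    rw [Finset.sum_ite_mem]
    simp
  constructor
  · intro hc
    calc -((Finset.Ioi j).card : ℤ)
      _ = ∑ i, if i ∈ Finset.Ioi j then (-1 : ℤ) else 0 := (hcard _).symm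
      _ ≤ ∑ i, ⌊c - x i⌋ := by
        refine Finset.sum_le_sum fun i _ => ?_
        split_ifs with hi <;> rw [Int.le_floor]
        · push_cast
          linarith [hspread i j]
        · have hij : i ≤ j := not_lt.1 (Finset.mem_Ioi.not.1 hi)
          push_cast
          linarith [hmono hij]
  · contrapose!
    intro hc
    calc ∑ i, ⌊c - x i⌋ ≤ ∑ i, if i ∈ Finset.Ici j then (-1 : ℤ) else 0 := by
          refine Finset.sum_le_sum fun i _ => Int.lt_add_one_iff.1 (Int.floor_lt.2 ?_)
          split_ifs with hi
          · push_cast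
            linarith [hmono (Finset.mem_Ici.1 hi)]
          · push_cast
            linarith [hspread j i]
      _ = -((Finset.Ici j).card : ℤ) := hcard _
      _ < -((Finset.Ioi j).card : ℤ) := by
        rw [← Finset.Ioi_insert, Finset.card_insert_of_notMem Finset.notMem_Ioi_self]
        lia

lemma eq_of_circleExp_eq_comp_perm {n : ℕ} {x y : Fin n → ℝ} (hx : x ∈ alcove n)
    (hy : y ∈ alcove n) {u : Equiv.Perm (Fin n)} (h : circleExp ∘ x = circleExp ∘ y ∘ u) :
    x = y := by
  choose m hm using fun j => circleExp_eq_circleExp_iff.1 (congrFun h j)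
  have hm_sum : ∑ j, m j = 0 := by
    have hsum : ∑ j, x j = ∑ j, y (u j) + ∑ j, (m j : ℝ) := by
      rw [← Finset.sum_add_distrib]
      exact Finset.sum_congr rfl fun j _ => hm j
    rw [Equiv.sum_comp u y, hx.2.2, hy.2.2, zero_add] at hsum
    exact_mod_cast hsum.symm
  have hfloor (c : ℝ) : ∑ i, ⌊c - x i⌋ = ∑ i, ⌊c - y i⌋ := by
    simp only [hm, Function.comp_apply, ← sub_sub, Int.floor_sub_intCast, Finset.sum_sub_distrib,
      hm_sum, sub_zero]
    exact Equiv.sum_comp u fun i => ⌊c - y i⌋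
  refine funext fun j => eq_of_forall_ge_iff fun c => ?_
  rw [le_iff_neg_card_Ioi_le_sum_floor hx.1 hx.2.1, le_iff_neg_card_Ioi_le_sum_floor hy.1 hy.2.1,
    hfloor]

/- Lowering the largest coordinate by one keeps the spread at most one and decreases the sum. -/
lemma exists_sum_eq_zero_circleExp_eq {ι : Type*} [Fintype ι] (m : ℕ) {x : ι → ℝ}
    (hspread : ∀ i j, x i ≤ x j + 1) (hsum : ∑ j, x j = m) :
    ∃ y : ι → ℝ, (∀ i j, y i ≤ y j + 1) ∧ ∑ j, y j = 0 ∧ circleExp ∘ y = circleExp ∘ x := by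
  classical
  induction m generalizing x with
  | zero => exact ⟨x, hspread, by simpa using hsum, rfl⟩
  | succ m ih =>
    have : Nonempty ι := by
      by_contra! hempty
      rw [Finset.univ_eq_empty, Finset.sum_empty] at hsum
      exact Nat.cast_ne_zero.2 m.succ_ne_zero hsum.symm
    obtain ⟨k, hk⟩ := Finite.exists_max x
    obtain ⟨y, hy_spread, hy_sum, hy⟩ := ih (x := update x k (x k - 1))
      (fun i j => by
        simp only [update_apply]
        split_ifs <;> linarith [hspread k j, hspread i j, hk i])
      (by
        rw [← Finset.add_sum_erase _ _ (Finset.mem_univ k), Nat.cast_succ] at hsum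
        rw [Finset.sum_update_of_mem (Finset.mem_univ k), Finset.sdiff_singleton_eq_erase]
        linarith)
    refine ⟨y, hy_spread, hy_sum, hy.trans ?_⟩
    rw [comp_update, circleExp_sub_one]
    exact update_eq_self k (circleExp ∘ x)

lemma exists_mem_alcove_eq_circleExp_comp_perm {n : ℕ} {z : Fin n → ℂ} (hz : ∀ j, ‖z j‖ = 1)
    (hprod : ∏ j, z j = 1) :
    ∃ x ∈ alcove n, ∃ u : Equiv.Perm (Fin n), z = circleExp ∘ x ∘ u := by
  choose a ha using fun j => exists_circleExp_eq (hz j)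
  obtain ⟨k, hk⟩ : ∃ k : ℤ, ∑ j, Int.fract (a j) = 0 + k := by
    rw [← circleExp_eq_circleExp_iff, circleExp_sum, circleExp_zero]
    simpa only [circleExp_fract, ha] using hprod
  lift k to ℕ using by
    have : (0 : ℝ) ≤ k := by
      rw [← zero_add (k : ℝ), ← hk]
      exact Finset.sum_nonneg fun j _ => Int.fract_nonneg _
    exact_mod_cast this
  obtain ⟨y, hspread, hsum, hy⟩ := exists_sum_eq_zero_circleExp_eq (x := Int.fract ∘ a) k
    (fun i j => by
      simp only [Function.comp_apply]
      linarith [Int.fract_lt_one (a i), Int.fract_nonneg (a j)]) (by simpa using hk)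
  refine ⟨y ∘ Tuple.sort y, ⟨Tuple.monotone_sort y, fun i j => hspread _ _,
    (Equiv.sum_comp _ y).trans hsum⟩, (Tuple.sort y).symm, funext fun j => ?_⟩
  simpa [circleExp_fract, ha] using (congrFun hy j).symm

lemma openAlcove_subset_alcove (n : ℕ) : openAlcove n ⊆ alcove n :=
  fun _ hx => ⟨hx.1.monotone, fun i j => (hx.2.1 i j).le, hx.2.2⟩

lemma openSegment_subset_openAlcove {n : ℕ} {x y : Fin n → ℝ} (hx : x ∈ alcove n)
    (hy : y ∈ openAlcove n) : openSegment ℝ x y ⊆ openAlcove n := by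
  rintro _ ⟨a, b, ha, hb, hab, rfl⟩
  simp only [openAlcove, Set.mem_ofPred_eq, StrictMono, Pi.add_apply, Pi.smul_apply, smul_eq_mul,
    Finset.sum_add_distrib, ← Finset.mul_sum, hx.2.2, hy.2.2, mul_zero, add_zero, and_true]
  refine ⟨fun i j hij => ?_, fun i j => ?_⟩
  · linarith [mul_le_mul_of_nonneg_left (hx.1 hij.le) ha.le, mul_lt_mul_of_pos_left (hy.1 hij) hb]
  · linarith [mul_le_mul_of_nonneg_left (hx.2.1 i j) ha.le,
      mul_lt_mul_of_pos_left (hy.2.1 i j) hb]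

lemma circleExp_comp_injective {n : ℕ} {x : Fin n → ℝ} (hx : x ∈ openAlcove n) :
    Injective (circleExp ∘ x) := by
  intro i j hij
  obtain ⟨m, hm⟩ := circleExp_eq_circleExp_iff.1 hij
  have hm_lt : (m : ℝ) < 1 := by linarith [hx.2.1 i j]
  have hm_gt : (-1 : ℝ) < m := by linarith [hx.2.1 j i]
  obtain rfl : m = 0 := by
    have : m < 1 := by exact_mod_cast hm_lt
    have : -1 < m := by exact_mod_cast hm_gt
    lia
  exact hx.1.injective (by simpa using hm)

lemma balance_mem_alcove {n : ℕ} {x : Fin n → ℝ} (hmono : Monotone x)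
    (hspread : ∀ i j, x i ≤ x j + 1) : Fintype.balance x ∈ alcove n := by
  refine ⟨fun i j hij => sub_le_sub_right (hmono hij) _, fun i j => ?_, Fintype.sum_balance x⟩
  simp only [Fintype.balance_apply]
  linarith [hspread i j]

lemma balance_mem_openAlcove {n : ℕ} {x : Fin n → ℝ} (hmono : StrictMono x)
    (hspread : ∀ i j, x i < x j + 1) : Fintype.balance x ∈ openAlcove n := by
  refine ⟨fun i j hij => sub_lt_sub_right (hmono hij) _, fun i j => ?_, Fintype.sum_balance x⟩
  simp only [Fintype.balance_apply]
  linarith [hspread i j]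

lemma circleExp_balance_eq_iff {ι : Type*} [Fintype ι] {x : ι → ℝ} {i j : ι} :
    circleExp (Fintype.balance x i) = circleExp (Fintype.balance x j) ↔
      circleExp (x i) = circleExp (x j) := by
  simp only [Fintype.balance_apply, circleExp_sub_eq_circleExp_sub_iff]

/-- The barycentre of the alcove, used as a base point of its interior. -/
noncomputable def barycentre (n : ℕ) : Fin n → ℝ :=
  Fintype.balance fun i => (i : ℝ) / n

lemma barycentre_mem_openAlcove (n : ℕ) : barycentre n ∈ openAlcove n := by
  refine balance_mem_openAlcove (fun i j hij => ?_) fun i j => ?_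
  · have hn : (0 : ℝ) < n := by exact_mod_cast i.pos
    exact div_lt_div_of_pos_right (by exact_mod_cast hij) hn
  · have hn : (0 : ℝ) < n := by exact_mod_cast i.pos
    have hi : (i : ℝ) / n < 1 := (div_lt_one hn).2 (by exact_mod_cast i.2)
    have hj : (0 : ℝ) ≤ (j : ℝ) / n := by positivity
    linarith

lemma barycentre_mem_alcove (n : ℕ) : barycentre n ∈ alcove n :=
  openAlcove_subset_alcove n (barycentre_mem_openAlcove n)

lemma isConnected_openAlcove (n : ℕ) : IsConnected (openAlcove n) :=
  ⟨⟨_, barycentre_mem_openAlcove n⟩, (convex_iff_openSegment_subset.2 fun _ hx _ hy =>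
    openSegment_subset_openAlcove (openAlcove_subset_alcove n hx) hy).isPreconnected⟩

lemma alcove_subset_closure_openAlcove (n : ℕ) : alcove n ⊆ closure (openAlcove n) := by
  intro x hx
  have hseg : x ∈ closure (openSegment ℝ x (barycentre n)) := by
    rw [closure_openSegment]
    exact left_mem_segment ℝ _ _
  exact closure_mono (openSegment_subset_openAlcove hx (barycentre_mem_openAlcove n)) hseg

/-- A point of the alcove (the midpoint of an edge) all of whose angles, except the one in
position `p`, agree modulo `1`. -/
noncomputable def edgeMidpoint {n : ℕ} (p : Fin n) : Fin n → ℝ :=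
  Fintype.balance fun i => if i < p then 0 else if i = p then 1 / 2 else 1

lemma edgeMidpoint_mem_alcove {n : ℕ} (p : Fin n) : edgeMidpoint p ∈ alcove n := by
  refine balance_mem_alcove (fun i j hij => ?_) fun i j => ?_
  · split_ifs <;> first | (exfalso; lia) | norm_num
  · split_ifs <;> norm_num

lemma circleExp_edgeMidpoint_eq_iff {n : ℕ} {p i j : Fin n} :
    circleExp (edgeMidpoint p i) = circleExp (edgeMidpoint p j) ↔ (i = p ↔ j = p) := by
  have hhalf : circleExp (1 / 2) = -1 := by
    rw [circleExp, ← Complex.exp_pi_mul_I]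
    push_cast
    ring_nf
  have hone : circleExp 1 = 1 := by rw [← circleExp_sub_one, sub_self, circleExp_zero]
  have hvalue (k : Fin n) :
      circleExp (if k < p then 0 else if k = p then 1 / 2 else 1) = if k = p then -1 else 1 := by
    split_ifs with hlt heq
    · exact absurd heq hlt.ne
    · exact circleExp_zero
    · exact hhalf
    · exact hone
  rw [edgeMidpoint, circleExp_balance_eq_iff, hvalue, hvalue]
  split_ifs with hi hj hj <;> norm_num [hi, hj]

lemma exists_forall_mem_alcove_eq {n : ℕ} {g : (Fin n → ℝ) → ℂ} (hg : Continuous g)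
    (h : ∀ x ∈ alcove n, ∃ j, g x = circleExp (x j)) :
    ∃ j, ∀ x ∈ alcove n, g x = circleExp (x j) := by
  have hcont (j : Fin n) : Continuous fun x : Fin n → ℝ => circleExp (x j) :=
    continuous_circleExp.comp (continuous_apply j)
  obtain ⟨j, hj⟩ := exists_eqOn_of_forall_exists_eq (isConnected_openAlcove n) hg.continuousOn
    (fun j => (hcont j).continuousOn) (fun x hx => circleExp_comp_injective hx)
    fun x hx => h x (openAlcove_subset_alcove n hx)
  exact ⟨j, fun x hx => hj.closure hg (hcont j) (alcove_subset_closure_openAlcove n hx)⟩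

namespace diagSU

variable {n : ℕ}

lemma diagonal_diag_toMatrix (X : diagSU n) : diagonal (toMatrix X).diag = toMatrix X :=
  IsDiag.diagonal_diag X.2

lemma ext_diag {X Y : diagSU n} (h : (toMatrix X).diag = (toMatrix Y).diag) : X = Y := by
  refine Subtype.ext (Subtype.ext ?_)
  change toMatrix X = toMatrix Y
  rw [← diagonal_diag_toMatrix, h, diagonal_diag_toMatrix]

/-- The diagonal matrix whose angles, in units of `2π`, are the coordinates of `x` shifted by their
mean; the shift makes the determinant one, so that this is defined and continuous for all `x`. -/
noncomputable def ofAngles (x : Fin n → ℝ) : diagSU n :=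
  ⟨⟨diagonal (circleExp ∘ Fintype.balance x), diagonal_mem_specialUnitaryGroup_iff.2
    ⟨fun _ => norm_circleExp _, by
      simp only [Function.comp_apply, ← circleExp_sum, Fintype.sum_balance, circleExp_zero]⟩⟩,
    isDiag_diagonal _⟩

lemma continuous_ofAngles : Continuous (ofAngles (n := n)) := by
  have hbalance : Continuous fun x : Fin n → ℝ => Fintype.balance x := by
    refine continuous_pi fun i => ?_
    simp only [Fintype.balance_apply, Fintype.expect_eq_sum_div_card]
    fun_prop
  refine Continuous.subtype_mk (Continuous.subtype_mk (Continuous.matrix_diagonal ?_) _) _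
  exact continuous_pi fun i => continuous_circleExp.comp ((continuous_apply i).comp hbalance)

lemma diag_ofAngles_comp {x : Fin n → ℝ} (hx : x ∈ alcove n) (u : Equiv.Perm (Fin n)) :
    (toMatrix (ofAngles (x ∘ u))).diag = circleExp ∘ x ∘ u := by
  have hsum : ∑ i, (x ∘ u) i = 0 := (Equiv.sum_comp u x).trans hx.2.2
  have hbalance : Fintype.balance (x ∘ u) = x ∘ u := by
    funext i
    rw [Fintype.balance_apply, Fintype.expect_eq_sum_div_card, hsum, zero_div, sub_zero]
  exact (diag_diagonal _).trans (by rw [hbalance])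

lemma exists_diag_eq_circleExp_comp (X : diagSU n) :
    ∃ x ∈ alcove n, ∃ u : Equiv.Perm (Fin n), (toMatrix X).diag = circleExp ∘ x ∘ u := by
  have hX : diagonal (toMatrix X).diag ∈ specialUnitaryGroup (Fin n) ℂ :=
    (diagonal_diag_toMatrix X).symm ▸ X.1.2
  rw [diagonal_mem_specialUnitaryGroup_iff] at hX
  exact exists_mem_alcove_eq_circleExp_comp_perm hX.1 hX.2

lemma exists_eq_ofAngles_comp (X : diagSU n) :
    ∃ x ∈ alcove n, ∃ u : Equiv.Perm (Fin n), X = ofAngles (x ∘ u) := by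
  obtain ⟨x, hx, u, hu⟩ := exists_diag_eq_circleExp_comp X
  exact ⟨x, hx, u, ext_diag (hu.trans (diag_ofAngles_comp hx u).symm)⟩

lemma isOrderedEigenangles_iff {X : diagSU n} {x : Fin n → ℝ} :
    IsOrderedEigenangles (toMatrix X) x ↔
      x ∈ alcove n ∧ ∃ u : Equiv.Perm (Fin n), (toMatrix X).diag = circleExp ∘ x ∘ u := by
  have hroots : (toMatrix X).charpoly.roots = Finset.univ.val.map (toMatrix X).diag := by
    rw [← roots_charpoly_diagonal, diagonal_diag_toMatrix]
  constructor
  · intro h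
    exact ⟨⟨h.mono, h.spread, h.sum_eq_zero⟩, univ_val_map_eq_iff.1 (hroots.symm.trans h.roots_eq)⟩
  · rintro ⟨⟨hmono, hspread, hsum⟩, hx⟩
    exact ⟨hmono, hspread, hsum, hroots.trans (univ_val_map_eq_iff.2 hx)⟩

lemma existsUnique_isOrderedEigenangles (X : diagSU n) :
    ∃! x : Fin n → ℝ, IsOrderedEigenangles (toMatrix X) x := by
  simp only [isOrderedEigenangles_iff]
  obtain ⟨x, hx, u, hu⟩ := exists_diag_eq_circleExp_comp X
  refine ⟨x, ⟨hx, u, hu⟩, fun y ⟨hy, v, hv⟩ => eq_of_circleExp_eq_comp_perm hy hx (u := u * v⁻¹) ?_⟩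
  funext j
  simpa using congrFun (hv.symm.trans hu) (v⁻¹ j)

/-- The eigenvalues `λ₁(X), …, λₙ(X)`, in the order of the eigenangles of `X` in the alcove. -/
noncomputable def orderedEigenvalue (X : diagSU n) : Fin n → ℂ :=
  circleExp ∘ (existsUnique_isOrderedEigenangles X).choose

lemma orderedEigenvalue_eq {X : diagSU n} {x : Fin n → ℝ}
    (h : IsOrderedEigenangles (toMatrix X) x) : orderedEigenvalue X = circleExp ∘ x := by
  have hX := existsUnique_isOrderedEigenangles X
  rw [orderedEigenvalue, hX.unique hX.choose_spec.1 h]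

lemma orderedEigenvalue_ofAngles_comp {x : Fin n → ℝ} (hx : x ∈ alcove n)
    (u : Equiv.Perm (Fin n)) : orderedEigenvalue (ofAngles (x ∘ u)) = circleExp ∘ x :=
  orderedEigenvalue_eq (isOrderedEigenangles_iff.2 ⟨hx, u, diag_ofAngles_comp hx u⟩)

lemma exists_forall_ofAngles_comp_eq {f : diagSU n → ℂ} (hf : Continuous f)
    (h : ∀ X, ∃ j, f X = (toMatrix X).diag j) (u : Equiv.Perm (Fin n)) :
    ∃ p, ∀ x ∈ alcove n, f (ofAngles (x ∘ u)) = circleExp (x p) := by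
  refine exists_forall_mem_alcove_eq (g := fun x => f (ofAngles (x ∘ u)))
    (hf.comp (continuous_ofAngles.comp (by fun_prop))) fun x hx => ?_
  obtain ⟨j, hj⟩ := h (ofAngles (x ∘ u))
  exact ⟨u j, hj.trans (congrFun (diag_ofAngles_comp hx u) j)⟩

lemma ofAngles_edgeMidpoint_comp_eq {u v : Equiv.Perm (Fin n)} {i : Fin n} (h : v i = u i) :
    ofAngles (edgeMidpoint (u i) ∘ v) = ofAngles (edgeMidpoint (u i) ∘ u) := by
  refine ext_diag ?_
  have hmem := edgeMidpoint_mem_alcove (u i)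
  rw [diag_ofAngles_comp hmem, diag_ofAngles_comp hmem]
  funext k
  refine circleExp_edgeMidpoint_eq_iff.2 ?_
  rw [← h, v.injective.eq_iff, h, u.injective.eq_iff]

lemma eq_orderedEigenvalue_or_eq_diag {f : diagSU n → ℂ} (hf : Continuous f)
    (h : ∀ X, ∃ j, f X = (toMatrix X).diag j) :
    (∃ p, ∀ X, f X = orderedEigenvalue X p) ∨ ∃ j, ∀ X, f X = (toMatrix X).diag j := by
  choose t ht using exists_forall_ofAngles_comp_eq hf h
  have ht_edge (u v : Equiv.Perm (Fin n)) (i : Fin n) (hu : t u = u i) (hv : v i = u i) :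
      t v = t u := by
    have hmem := edgeMidpoint_mem_alcove (u i)
    have heq : circleExp (edgeMidpoint (u i) (t v)) = circleExp (edgeMidpoint (u i) (t u)) := by
      rw [← ht v _ hmem, ← ht u _ hmem, ofAngles_edgeMidpoint_comp_eq hv]
    exact ((circleExp_edgeMidpoint_eq_iff.1 heq).2 hu).trans hu.symm
  rcases exists_forall_eq_or_exists_forall_eq_apply t ht_edge with ⟨p, hp⟩ | ⟨j, hj⟩
  · refine .inl ⟨p, fun X => ?_⟩
    obtain ⟨x, hx, u, rfl⟩ := exists_eq_ofAngles_comp X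
    rw [ht u x hx, hp, orderedEigenvalue_ofAngles_comp hx, Function.comp_apply]
  · refine .inr ⟨j, fun X => ?_⟩
    obtain ⟨x, hx, u, rfl⟩ := exists_eq_ofAngles_comp X
    rw [ht u x hx, hj, diag_ofAngles_comp hx, Function.comp_apply, Function.comp_apply]

lemma injective_diag_ofAngles_barycentre_comp (u : Equiv.Perm (Fin n)) :
    Injective (toMatrix (ofAngles (barycentre n ∘ u))).diag := by
  rw [diag_ofAngles_comp (barycentre_mem_alcove n)]
  exact (circleExp_comp_injective (barycentre_mem_openAlcove n)).comp u.injective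

lemma forall_eq_diag_or_forall_eq_orderedEigenvalue {f : diagSU n → Fin n → ℂ}
    (hf : Continuous f) (h : ∀ X, Set.range (f X) = Set.range (toMatrix X).diag) :
    (∀ i, ∃ j, ∀ X, f X i = (toMatrix X).diag j) ∨
      ∀ i, ∃ p, ∀ X, f X i = orderedEigenvalue X p := by
  have hdich (i : Fin n) := eq_orderedEigenvalue_or_eq_diag (f := fun X => f X i)
    ((continuous_apply i).comp hf) fun X => by
      obtain ⟨j, hj⟩ := (h X).le (Set.mem_range_self i)
      exact ⟨j, hj.symm⟩
  by_contra hmixed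
  obtain ⟨hdiag, hordered⟩ := not_or.1 hmixed
  obtain ⟨i, hi⟩ := not_forall.1 hdiag
  obtain ⟨k, hk⟩ := not_forall.1 hordered
  obtain ⟨p, hp⟩ := (hdich i).resolve_right hi
  obtain ⟨j, hj⟩ := (hdich k).resolve_left hk
  let X := ofAngles (barycentre n ∘ Equiv.swap j p)
  have heq : f X i = f X k := by
    rw [hp, hj, orderedEigenvalue_ofAngles_comp (barycentre_mem_alcove n),
      diag_ofAngles_comp (barycentre_mem_alcove n)]
    simp
  obtain rfl := injective_of_range_eq (h X) (injective_diag_ofAngles_barycentre_comp _) heq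
  exact hi ⟨j, hj⟩

end diagSU

open diagSU in
lemma exists_eq_matrixAd_diagonal {n : ℕ} {φ : diagSU n → Matrix (Fin n) (Fin n) ℂ}
    (hcont : Continuous φ) (hspec : SpectrumPreserving φ) (hcomm : CommutativityPreserving φ) :
    ∃ (T : GL (Fin n) ℂ) (f : diagSU n → Fin n → ℂ), Continuous f ∧
      (∀ X, φ X = matrixAd T (diagonal (f X))) ∧
        ∀ X, Set.range (f X) = Set.range (toMatrix X).diag := by
  have hspec_diag (X : diagSU n) : spectrum ℂ (φ X) = Set.range (toMatrix X).diag := by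
    rw [hspec, ← spectrum_diagonal, diagonal_diag_toMatrix]
  have hcommute (X Y : diagSU n) : Commute (φ X) (φ Y) := by
    refine hcomm X Y ?_
    rw [← diagonal_diag_toMatrix X, ← diagonal_diag_toMatrix Y]
    exact commute_diagonal _ _
  obtain ⟨T, hT⟩ := exists_forall_commute_isDiag
    (injective_diag_ofAngles_barycentre_comp (n := n) 1) (A := φ (ofAngles (barycentre n ∘ _)))
    fun i => (hspec_diag _).ge (Set.mem_range_self i)
  let f (X : diagSU n) : Fin n → ℂ := ((↑T⁻¹ : Matrix (Fin n) (Fin n) ℂ) * φ X * T).diag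
  have hf (X : diagSU n) : (↑T⁻¹ : Matrix (Fin n) (Fin n) ℂ) * φ X * T = diagonal (f X) :=
    (hT _ (hcommute _ _)).diagonal_diag.symm
  refine ⟨T, f, by fun_prop, fun X => ?_, fun X => ?_⟩
  · rw [matrixAd, ← hf]
    simp only [mul_assoc, Units.mul_inv_cancel_left, Units.mul_inv, mul_one]
  · rw [← spectrum_diagonal, ← hf, spectrum.units_conjugate', hspec_diag]

theorem theorem1p2 (n : ℕ) (hn : 1 ≤ n) (φ : diagSU n → Matrix (Fin n) (Fin n) ℂ)
    (hcont : Continuous φ) (hspec : SpectrumPreserving φ) (hcomm : CommutativityPreserving φ) :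
    (∀ X : diagSU n, ∃! x : Fin n → ℝ, IsOrderedEigenangles (diagSU.toMatrix X) x) ∧
      ((∃ T : GL (Fin n) ℂ, ∀ X : diagSU n, φ X = matrixAd T (diagSU.toMatrix X)) ∨
        (∃ T : GL (Fin n) ℂ, ∀ (X : diagSU n) (x : Fin n → ℝ),
          IsOrderedEigenangles (diagSU.toMatrix X) x →
            φ X = matrixAd T (Matrix.diagonal fun j => circleExp (x j)))) := by
  refine ⟨diagSU.existsUnique_isOrderedEigenangles, ?_⟩
  obtain ⟨T, f, hf, hφ, hrange⟩ := exists_eq_matrixAd_diagonal hcont hspec hcomm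
  have hinj := injective_of_range_eq (hrange _) (diagSU.injective_diag_ofAngles_barycentre_comp 1)
  rcases diagSU.forall_eq_diag_or_forall_eq_orderedEigenvalue hf hrange with h | h
  · obtain ⟨T', hT'⟩ := exists_forall_eq_matrixAd_diagonal hφ hinj h
    exact .inl ⟨T', fun X => by rw [hT', diagSU.diagonal_diag_toMatrix]⟩
  · obtain ⟨T', hT'⟩ := exists_forall_eq_matrixAd_diagonal hφ hinj h
    refine .inr ⟨T', fun X x hx => ?_⟩
    rw [hT', diagSU.orderedEigenvalue_eq hx]
    rfl
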